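/- Let $n\ge 0$ and let $a_1,\dots,a_n,b_1,\dots,b_n$ be $2n$ pairwise distinct points of the open unit disc. Put $$B_{\bf a}(z)=\prod_{j=1}^n\frac{z-a_j}{1-\bar a_jz},\qquad B_{\bf b}(z)=\prod_{k=1}^n\frac{z-b_k}{1-\bar b_kz},\qquad \varphi=B_{\bf a}/B_{\bf b}\ \text{ on }\mathbb T,$$ let $c_w(z)=1/(1-\bar wz)$ denote the Szegő kernel at $w$, let $H^2=H^2(\mathbb T)\subset L^2(\mathbb T)$ be the Hardy space with orthogonal projection $P_0$, let $T_\varphi=P_0M_\varphi|_{H^2}$ be the Toeplitz operator with symbol $\varphi$, and let $\mathcal K_{{\bf a}{\bf b}}=H^2\ominus B_{\bf a}B_{\bf b}H^2$ be the model space. A singular value decomposition of a bounded operator $T$ is a pointwise convergent representation $Th=\sum_i s_i\langle h,g_i\rangle f_i$ with orthonormal systems $(f_i)$, $(g_i)$ and numbers $s_i>0$; the $s_i$, repeated according to multiplicity, are the singular values of $T$. Then $\mathcal K_{{\bf a}{\bf b}}$ is finite dimensional and is the (in general non-orthogonal) direct sum of $\mathcal S=\operatorname{span}\{c_{a_1},\dots,c_{a_n}\}$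 and $\mathcal T=\operatorname{span}\{c_{b_1},\dots,c_{b_n}\}$. Let $Q$ be the oblique projection of $\mathcal K_{{\bf a}{\bf b}}$ onto $\mathcal S$ along $\mathcal T$, and let $\beta_1\ge\dots\ge\beta_n$ be the $n$ largest singular values, with multiplicity, of its corner $Q|_{\mathcal S^\perp}:\mathcal S^\perp\to\mathcal S$, where $\mathcal S^\perp=\mathcal K_{{\bf a}{\bf b}}\ominus\mathcal S$. The operator $T_\varphi$ has a singular value decomposition, its singular values are all at most $1$, only finitely many of them (counted with multiplicity) are strictly less than $1$, and these are exactly, with multiplicity, the $n$ numbers $$s_k=\frac{\beta_k}{\sqrt{\beta_k^2+1}},\qquad k=1,\dots,n.$$ -/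

import Mathlib

open MeasureTheory
open scoped ComplexConjugate ENNReal Complex.UnitDisc

noncomputable section

/-- `L²(𝕋)` with normalised arc length, the circle `𝕋` being parametrised by
`x ↦ AddCircle.toCircle x = exp (2πix)`, `x ∈ ℝ/ℤ`. -/
abbrev L2T : Type := Lp ℂ 2 (AddCircle.haarAddCircle : Measure UnitAddCircle)

/-- The Hardy space `H²(𝕋)`: the functions in `L²(𝕋)` all of whose Fourier coefficients of negative
index vanish. -/
def hardySpace : Submodule ℂ L2T where
  carrier := {f | ∀ n : ℤ, n < 0 → fourierCoeff (f : UnitAddCircle → ℂ) n = 0}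
  zero_mem' n _ := by rw [← fourierBasis_repr]; simp
  add_mem' {f g} hf hg n hn := by
    have h1 := hf n hn
    have h2 := hg n hn
    rw [← fourierBasis_repr] at h1 h2 ⊢
    simp [h1, h2]
  smul_mem' c f hf n hn := by
    have h1 := hf n hn
    rw [← fourierBasis_repr] at h1 ⊢
    simp [h1]

theorem isClosed_hardySpace : IsClosed (hardySpace : Set L2T) := by
  have h : (hardySpace : Set L2T) = ⋂ (n : ℤ) (_ : n < 0),
      {f : L2T | inner ℂ (fourierBasis (T := 1) n) f = 0} := by
    ext f
    simp only [Set.mem_iInter, Set.mem_ofPred_eq, SetLike.mem_coe]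
    refine forall₂_congr fun n _ => ?_
    rw [← fourierBasis_repr, HilbertBasis.repr_apply_apply]
  rw [h]
  exact isClosed_iInter fun n => isClosed_iInter fun _ =>
    isClosed_eq (by fun_prop) continuous_const

instance : CompleteSpace hardySpace := isClosed_hardySpace.completeSpace_coe

/-- The multiplication operator `M_φ f = φ f` on `L²(𝕋)`. -/
def mulOp (φ : C(UnitAddCircle, ℂ)) : L2T →L[ℂ] L2T :=
  (ContinuousLinearMap.mul ℂ ℂ).holderL AddCircle.haarAddCircle ∞ 2 2
    (ContinuousMap.toLp ∞ AddCircle.haarAddCircle ℂ φ)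

theorem coeFn_mulOp (φ : C(UnitAddCircle, ℂ)) (f : L2T) :
    mulOp φ f =ᵐ[AddCircle.haarAddCircle] fun x => φ x * f x := by
  have h1 := (ContinuousLinearMap.mul ℂ ℂ).coeFn_holder (r := 2)
    (ContinuousMap.toLp ∞ AddCircle.haarAddCircle ℂ φ) f
  have h2 := ContinuousMap.coeFn_toLp (p := ∞) (𝕜 := ℂ) AddCircle.haarAddCircle φ
  filter_upwards [h1, h2] with x hx1 hx2
  rw [← hx2]
  exact hx1

/-- The Toeplitz operator `T_φ = P M_φ|_{H²}` on `H²(𝕋)`, where `P` is the orthogonal projection of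
`L²(𝕋)` onto `H²(𝕋)`. -/
def toeplitz (φ : C(UnitAddCircle, ℂ)) : hardySpace →L[ℂ] hardySpace :=
  hardySpace.orthogonalProjectionOnto ∘L mulOp φ ∘L hardySpace.subtypeL

theorem one_sub_conj_mul_ne_zero (a : 𝔻) (z : Circle) : 1 - conj (a : ℂ) * (z : ℂ) ≠ 0 := by
  intro h
  have h1 : ‖conj (a : ℂ) * (z : ℂ)‖ = 1 := by rw [← sub_eq_zero.mp h, norm_one]
  have h2 := a.norm_lt_one
  rw [norm_mul, Complex.norm_conj, z.norm_coe, mul_one] at h1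
  linarith

theorem sub_coe_ne_zero (a : 𝔻) (z : Circle) : (z : ℂ) - a ≠ 0 := by
  intro h
  have h1 : ‖(z : ℂ)‖ = 1 := z.norm_coe
  have h2 := a.norm_lt_one
  rw [sub_eq_zero.mp h] at h1
  linarith

/-- The finite Blaschke product `B_a(z) = ∏ⱼ (z - aⱼ) / (1 - āⱼ z)`. -/
def blaschke {n : ℕ} (a : Fin n → 𝔻) (z : ℂ) : ℂ :=
  ∏ j, (z - a j) / (1 - conj (a j : ℂ) * z)

theorem blaschke_ne_zero {n : ℕ} (a : Fin n → 𝔻) (z : Circle) : blaschke a z ≠ 0 :=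
  Finset.prod_ne_zero_iff.mpr fun j _ =>
    div_ne_zero (sub_coe_ne_zero (a j) z) (one_sub_conj_mul_ne_zero (a j) z)

theorem continuous_blaschke {n : ℕ} (a : Fin n → 𝔻) :
    Continuous fun x : UnitAddCircle => blaschke a (AddCircle.toCircle x) := by
  have h : Continuous fun x : UnitAddCircle => (AddCircle.toCircle x : ℂ) :=
    continuous_subtype_val.comp AddCircle.continuous_toCircle
  exact continuous_finsetProd _ fun j _ => (h.sub continuous_const).div
    (continuous_const.sub (continuous_const.mul h)) fun x => one_sub_conj_mul_ne_zero (a j) _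

/-- The restriction of `B_a` to the circle. -/
def blaschkeT {n : ℕ} (a : Fin n → 𝔻) : C(UnitAddCircle, ℂ) :=
  ⟨fun x => blaschke a (AddCircle.toCircle x), continuous_blaschke a⟩

/-- The function `B_a / B_b` on the circle. -/
def blaschkeQuotient {n m : ℕ} (a : Fin n → 𝔻) (b : Fin m → 𝔻) : C(UnitAddCircle, ℂ) :=
  ⟨fun x => blaschke a (AddCircle.toCircle x) / blaschke b (AddCircle.toCircle x),
    (continuous_blaschke a).div (continuous_blaschke b) fun _ => blaschke_ne_zero b _⟩

/-- The Szegő kernel `c_a(z) = 1 / (1 - ā z)`, as an element of `L²(𝕋)`. -/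
def szego (a : 𝔻) : L2T :=
  ContinuousMap.toLp 2 AddCircle.haarAddCircle ℂ
    ⟨fun x : UnitAddCircle => 1 / (1 - conj (a : ℂ) * (AddCircle.toCircle x : ℂ)),
      continuous_const.div (continuous_const.sub (continuous_const.mul
        (continuous_subtype_val.comp AddCircle.continuous_toCircle)))
        fun _ => one_sub_conj_mul_ne_zero a _⟩

/-- The span of the Szegő kernels `c_{a₁}, …, c_{aₙ}`. -/
def szegoSpan {n : ℕ} (a : Fin n → 𝔻) : Submodule ℂ L2T :=
  Submodule.span ℂ (Set.range fun j => szego (a j))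

/-- The model space `K_a = H² ⊖ B_a H²`. -/
def modelSpace {n : ℕ} (a : Fin n → 𝔻) : Submodule ℂ L2T :=
  hardySpace ⊓ (hardySpace.map (mulOp (blaschkeT a)).toLinearMap)ᗮ

/-- `T = ∑ᵢ sᵢ ⟨·, gᵢ⟩ fᵢ` (pointwise convergence) with `(fᵢ)`, `(gᵢ)` orthonormal systems and
`sᵢ > 0`: a singular value decomposition of `T`, whose singular values, repeated according to
multiplicity, are the `sᵢ`. -/
structure IsSVD {E F ι : Type*} [NormedAddCommGroup E] [InnerProductSpace ℂ E]
    [NormedAddCommGroup F] [InnerProductSpace ℂ F]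
    (T : E →L[ℂ] F) (s : ι → ℝ) (f : ι → F) (g : ι → E) : Prop where
  pos : ∀ i, 0 < s i
  left_orthonormal : Orthonormal ℂ f
  right_orthonormal : Orthonormal ℂ g
  hasSum : ∀ h : E, HasSum (fun i => ((s i : ℂ) * inner ℂ (g i) h) • f i) (T h)

/-- For a decomposition `K = S ∔ T`, the restriction to `S^⊥` of the oblique projection `Q` of `K`
onto `S` along `T`. -/
def obliqueCorner {K : Type*} [NormedAddCommGroup K] [InnerProductSpace ℂ K]
    (S T : Submodule ℂ K) (h : IsCompl S T) : Sᗮ →ₗ[ℂ] S :=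
  S.projectionOnto T h ∘ₗ Sᗮ.subtype

/-- The singular values `β₀ ≥ β₁ ≥ …` of `Q|_{S^⊥} : S^⊥ → S`, where `Q` is the oblique projection
of `K` onto `S` along `T`. -/
def obliqueSingularValues {K : Type*} [NormedAddCommGroup K] [InnerProductSpace ℂ K]
    [FiniteDimensional ℂ K] (S T : Submodule ℂ K) (h : IsCompl S T) : ℕ →₀ ℝ :=
  LinearMap.singularValues (𝕜 := ℂ) (E := Sᗮ) (F := S) (obliqueCorner S T h)

end

/-! Multiplication by a finite Blaschke product is an isometry of $H^2$. Put $A=T_{B_a}$,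
$B=T_{B_b}$. On the circle $1/B_b=\overline{B_b}$, so $T=T_\varphi=B^*A$, while $\ker A^*=\mathcal
S$ and $\ker B^*=\mathcal T$ (`modelSpace_eq_szegoSpan`). Since $BB^*=1-P_{\mathcal T}$, this gives
$T^*T=1-A^*P_{\mathcal T}A$, a perturbation of the identity of rank at most $n$.

The perturbation is diagonalised by the corner $q=Q|_{\mathcal S^\perp}$, because $\mathcal T$ is
the graph $\{w-qw : w\in\mathcal S^\perp\}$. If $q^*qv=\beta^2v$, then $P_{\mathcal
T}v=(v-qv)/(1+\beta^2)$. As $A^*$ kills $qv\in\mathcal S$ and $AA^*v=v$, the vector $A^*v$ is an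
eigenvector of $T^*T$ with eigenvalue $\beta^2/(1+\beta^2)$. On the orthogonal complement of these
vectors $T^*T$ is the identity. This is `exists_isSVD_adjoint_comp`.

Positivity of the singular values is injectivity of $T$ (`injective_toeplitz_blaschkeQuotient`): a
combination of $n$ kernels $c_{b_k}$ has a numerator of degree less than $n$ and cannot vanish at
the $n$ points $a_j$ unless it is zero. Finally, `IsSVD.exists_equiv` carries the values to an
arbitrary decomposition by counting dimensions of eigenspaces of $T^*T$. -/

section OrthonormalSystems

/-! ### Counting with orthonormal systems -/

variable {H : Type*} [NormedAddCommGroup H] [InnerProductSpace ℂ H]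

/-- A family of vectors is total if only `0` is orthogonal to all of them. -/
def IsTotalFamily {κ : Type*} (u : κ → H) : Prop :=
  ∀ h, (∀ k, inner ℂ (u k) h = 0) → h = 0

/-- If the members of an orthonormal family `g` with index in `I` only see the members of a total
orthonormal family `u` with index in the finite set `F`, then `I` has at most `F.ncard` elements. -/
theorem Orthonormal.finite_and_ncard_le {ι κ : Type*} {g : ι → H} (hg : Orthonormal ℂ g)
    {u : κ → H} (hu : Orthonormal ℂ u) (htot : IsTotalFamily u) {I : Set ι} {F : Set κ} (hF : F.Finite)
    (hIF : ∀ i ∈ I, ∀ k ∉ F, inner ℂ (u k) (g i) = 0) : I.Finite ∧ I.ncard ≤ F.ncard := by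
  classical
  have hspan : ∀ i : I, g i ∈ Submodule.span ℂ (u '' F) := fun i => by
    have h0 : g i - ∑ k ∈ hF.toFinset, inner ℂ (u k) (g i) • u k = 0 := by
      refine htot _ fun k => ?_
      rw [inner_sub_right]
      by_cases hk : k ∈ F
      · rw [hu.inner_right_sum _ (hF.mem_toFinset.2 hk), sub_self]
      · rw [hIF i i.2 k hk, zero_sub, neg_eq_zero, inner_sum]
        refine Finset.sum_eq_zero fun l hl => ?_
        have hkl : k ≠ l := fun h => hk (h ▸ hF.mem_toFinset.1 hl)
        rw [inner_smul_right, hu.2 hkl, mul_zero]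
    rw [sub_eq_zero.1 h0]
    exact Submodule.sum_mem _ fun k hk => Submodule.smul_mem _ _
      (Submodule.subset_span ⟨k, hF.mem_toFinset.1 hk, rfl⟩)
  have hli : LinearIndependent ℂ
      (fun i : I => (⟨g i, hspan i⟩ : Submodule.span ℂ (u '' F))) := by
    have := (hg.comp (fun i : I => (i : ι)) Subtype.val_injective).linearIndependent
    exact LinearIndependent.of_comp (Submodule.span ℂ (u '' F)).subtype this
  have hfin : (u '' F).Finite := hF.image u
  have : FiniteDimensional ℂ (Submodule.span ℂ (u '' F)) := FiniteDimensional.span_of_finite ℂ hfin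
  have hI : Finite I := hli.finite
  have := Fintype.ofFinite I
  refine ⟨Set.toFinite I, ?_⟩
  have h1 := hli.fintype_card_le_finrank
  have := hfin.fintype
  have h2 := finrank_span_le_card (R := ℂ) (u '' F)
  rw [← Set.ncard_eq_toFinset_card'] at h2
  rw [← Nat.card_coe_set_eq, Nat.card_eq_fintype_card]
  exact h1.trans (h2.trans (Set.ncard_image_le hF))

/-- By Bessel each `u k` has only countably many nonzero coefficients against `g`, and by totality
every `g i` meets some `u k`. -/
theorem Orthonormal.countable_of_isTotalFamily {ι κ : Type*} [Countable κ] {g : ι → H}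
    (hg : Orthonormal ℂ g) {u : κ → H} (htot : IsTotalFamily u) : Countable ι := by
  have h1 : ∀ k, {i | inner ℂ (g i) (u k) ≠ 0}.Countable := fun k => by
    refine (hg.inner_products_summable (u k)).countable_support.mono fun i hi => ?_
    simpa using hi
  have h2 : (Set.univ : Set ι) ⊆ ⋃ k, {i | inner ℂ (g i) (u k) ≠ 0} := fun i _ => by
    by_contra h
    refine hg.ne_zero i (htot _ fun k => ?_)
    simp only [Set.mem_iUnion, not_exists, Set.mem_ofPred_eq, not_not] at h
    exact inner_eq_zero_symm.1 (h k)
  exact Set.countable_univ_iff.1 ((Set.countable_iUnion h1).mono h2)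

theorem Orthonormal.infinite_of_isTotalFamily {ι κ : Type*} [Infinite ι] {g : ι → H}
    (hg : Orthonormal ℂ g) {u : κ → H} (hu : Orthonormal ℂ u) (htot : IsTotalFamily u) :
    Infinite κ := by
  by_contra h
  have := not_infinite_iff_finite.1 h
  exact Set.infinite_univ (hg.finite_and_ncard_le hu htot (I := Set.univ) (F := Set.univ)
    Set.finite_univ fun _ _ k hk => (hk trivial).elim).1

/-- Two real families on finite types whose fibres have the same cardinalities agree up to a
reindexing. -/
theorem exists_equiv_of_ncard_fiber_eq {α β : Type*} [Finite α] [Finite β] (p : α → ℝ) (q : β → ℝ)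
    (h : ∀ r, {x | p x = r}.ncard = {y | q y = r}.ncard) : ∃ e : α ≃ β, ∀ x, q (e x) = p x := by
  have e0 : ∀ r, Nonempty ({x // p x = r} ≃ {y // q y = r}) := fun r =>
    Finite.card_eq.1 (h r)
  let e := fun r => (e0 r).some
  refine ⟨(Equiv.sigmaFiberEquiv p).symm.trans
    ((Equiv.sigmaCongrRight e).trans (Equiv.sigmaFiberEquiv q)), fun x => ?_⟩
  exact (e (p x) ⟨x, rfl⟩).2

end OrthonormalSystems

/-! ### Singular value decompositions and their uniqueness -/

section SingularValueDecompositions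

variable {H : Type*} [NormedAddCommGroup H] [InnerProductSpace ℂ H]

theorem IsSVD.apply_right {ι : Type*} {T : H →L[ℂ] H} {s : ι → ℝ} {f g : ι → H}
    (h : IsSVD T s f g) (i : ι) : T (g i) = (s i : ℂ) • f i := by
  classical
  refine (h.hasSum (g i)).unique ?_
  have := hasSum_single (f := fun j => ((s j : ℂ) * inner ℂ (g j) (g i)) • f j) i fun j hj => by
    rw [h.right_orthonormal.2 hj, mul_zero, zero_smul]
  simpa [inner_self_eq_norm_sq_to_K, h.right_orthonormal.1 i] using this

theorem IsSVD.inner_left {ι : Type*} {T : H →L[ℂ] H} {s : ι → ℝ} {f g : ι → H}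
    (h : IsSVD T s f g) (i : ι) (x : H) : inner ℂ (f i) (T x) = s i * inner ℂ (g i) x := by
  classical
  have h1 := (h.hasSum x).mapL (innerSL ℂ (f i))
  refine h1.unique ?_
  have := hasSum_single (f := fun j => innerSL ℂ (f i) (((s j : ℂ) * inner ℂ (g j) x) • f j)) i
    fun j hj => by
      rw [innerSL_apply_apply, inner_smul_right, h.left_orthonormal.2 hj.symm, mul_zero]
  simpa [inner_self_eq_norm_sq_to_K, h.left_orthonormal.1 i] using this

/-- The weak form of $T^*Tg_i=s_i^2g_i$, which needs no adjoint. -/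
theorem IsSVD.inner_apply_apply {ι : Type*} {T : H →L[ℂ] H} {s : ι → ℝ} {f g : ι → H}
    (h : IsSVD T s f g) (i : ι) (x : H) :
    inner ℂ (T (g i)) (T x) = (s i : ℂ) ^ 2 * inner ℂ (g i) x := by
  rw [h.apply_right, inner_smul_left, h.inner_left, Complex.conj_ofReal]
  ring

theorem IsSVD.isTotalFamily {ι : Type*} {T : H →L[ℂ] H} {s : ι → ℝ} {f g : ι → H}
    (h : IsSVD T s f g) (hT : Function.Injective T) : IsTotalFamily g := fun x hx => by
  refine hT ?_
  rw [map_zero]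
  refine (h.hasSum x).unique ?_
  simp [hx]

/-- Right singular vectors of two singular value decompositions of `T` that belong to different
singular values are orthogonal. -/
theorem IsSVD.inner_eq_zero {ι κ : Type*} {T : H →L[ℂ] H} {s : ι → ℝ} {f g : ι → H}
    {s' : κ → ℝ} {f' g' : κ → H} (h : IsSVD T s f g) (h' : IsSVD T s' f' g') {i : ι} {k : κ}
    (hik : s i ≠ s' k) : inner ℂ (g i) (g' k) = 0 := by
  have h1 := h.inner_apply_apply i (g' k)
  have h2 := h'.inner_apply_apply k (g i)
  rw [← inner_conj_symm, ← inner_conj_symm (g' k), ← Complex.ofReal_pow, ← Complex.conj_ofReal,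
    ← map_mul] at h2
  have h3 := (starRingEnd ℂ).injective h2
  rw [h1, ← sub_eq_zero, ← sub_mul, mul_eq_zero] at h3
  refine h3.resolve_left fun h4 => hik ?_
  rw [sub_eq_zero, ← Complex.ofReal_pow, Complex.ofReal_inj] at h4
  exact (pow_left_inj₀ (h.pos i).le (h'.pos k).le two_ne_zero).1 h4

/-- Conversely, an orthonormal basis of eigenvectors of $T^*T$ yields a decomposition: expand `x` in
that basis and apply `T` termwise. -/
theorem IsSVD.of_orthonormal [CompleteSpace H] {ι : Type*} {T : H →L[ℂ] H} {s : ι → ℝ} {g : ι → H}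
    (hg : Orthonormal ℂ g) (htot : IsTotalFamily g) (hs : ∀ i, 0 < s i)
    (hT : ∀ i x, inner ℂ (T (g i)) (T x) = (s i : ℂ) ^ 2 * inner ℂ (g i) x) :
    IsSVD T s (fun i => (s i : ℂ)⁻¹ • T (g i)) g where
  pos := hs
  right_orthonormal := hg
  left_orthonormal := by
    classical
    rw [orthonormal_iff_ite]
    intro i j
    have hi : (s i : ℂ) ≠ 0 := Complex.ofReal_ne_zero.2 (hs i).ne'
    rw [inner_smul_left, inner_smul_right, hT, orthonormal_iff_ite.1 hg]
    split_ifs with hij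
    · subst hij
      rw [map_inv₀, Complex.conj_ofReal]
      field_simp
    · simp
  hasSum x := by
    have hbot : (Submodule.span ℂ (Set.range g))ᗮ = ⊥ := by
      rw [Submodule.eq_bot_iff]
      exact fun y hy => htot y fun k => hy _ (Submodule.subset_span ⟨k, rfl⟩)
    have h1 := ((HilbertBasis.mkOfOrthogonalEqBot hg hbot).hasSum_repr x).mapL T
    refine h1.congr_fun fun i => ?_
    have hi : (s i : ℂ) ≠ 0 := Complex.ofReal_ne_zero.2 (hs i).ne'
    simp only [HilbertBasis.repr_apply_apply, HilbertBasis.coe_mkOfOrthogonalEqBot, map_smul,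
      smul_smul]
    congr 1
    field_simp

theorem IsSVD.reindex {ι κ : Type*} {T : H →L[ℂ] H} {s : ι → ℝ} {f g : ι → H}
    (h : IsSVD T s f g) (e : κ ≃ ι) : IsSVD T (s ∘ e) (f ∘ e) (g ∘ e) where
  pos _ := h.pos _
  left_orthonormal := h.left_orthonormal.comp e e.injective
  right_orthonormal := h.right_orthonormal.comp e e.injective
  hasSum x := e.hasSum_iff.2 (h.hasSum x)

/-- The singular values below `1` of an injective operator can be read off from any singular value
decomposition in which all others are equal to `1`. -/
theorem IsSVD.exists_equiv {ι κ : Type*} {n : ℕ} {T : H →L[ℂ] H} (hT : Function.Injective T)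
    {s' : Fin n ⊕ κ → ℝ} {f' g' : Fin n ⊕ κ → H} (h' : IsSVD T s' f' g')
    (hlt : ∀ k, s' (Sum.inl k) < 1) (hone : ∀ k, s' (Sum.inr k) = 1)
    {s : ι → ℝ} {f g : ι → H} (h : IsSVD T s f g) :
    (∀ i, s i ≤ 1) ∧ {i | s i < 1}.Finite ∧
      ∃ e : Fin n ≃ {i // s i < 1}, ∀ k, s (e k) = s' (Sum.inl k) := by
  have hle' : ∀ k, s' k ≤ 1 := by
    rintro (k | k)
    exacts [(hlt k).le, (hone k).le]
  -- A right singular vector with value above 1 would be orthogonal to the whole total family `g'`.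
  have hle : ∀ i, s i ≤ 1 := fun i => by
    by_contra! hi
    refine h.right_orthonormal.ne_zero i (h'.isTotalFamily hT _ fun k => h'.inner_eq_zero h ?_)
    exact ((hle' k).trans_lt hi).ne
  have hfin' : {k | s' k < 1}.Finite := by
    refine (Set.finite_range (Sum.inl : Fin n → Fin n ⊕ κ)).subset ?_
    rintro (k | k) hk
    · exact ⟨k, rfl⟩
    · exact absurd (hone k) (ne_of_lt hk)
  have hfin : {i | s i < 1}.Finite := by
    refine (h.right_orthonormal.finite_and_ncard_le h'.right_orthonormal (h'.isTotalFamily hT)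
      hfin' fun i hi k hk => h'.inner_eq_zero h ?_).1
    intro hki
    exact hk (hki.trans_lt hi)
  refine ⟨hle, hfin, ?_⟩
  -- Vectors for the value `r` in one system only see those for `r` in the other; apply the bound
  -- both ways.
  have hfib : ∀ r < 1, {i | s i = r}.ncard = {k | s' k = r}.ncard := fun r hr => by
    have f1 : {i | s i = r}.Finite := hfin.subset fun i hi => (Eq.trans_lt hi hr)
    have f2 : {k | s' k = r}.Finite := hfin'.subset fun i hi => (Eq.trans_lt hi hr)
    refine le_antisymm
      (h.right_orthonormal.finite_and_ncard_le h'.right_orthonormal (h'.isTotalFamily hT) f2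
        fun i hi k hk => h'.inner_eq_zero h fun hki => hk (hki.trans hi)).2
      (h'.right_orthonormal.finite_and_ncard_le h.right_orthonormal (h.isTotalFamily hT) f1
        fun i hi k hk => h.inner_eq_zero h' fun hki => hk (hki.trans hi)).2
  have : Finite {i // s i < 1} := hfin
  refine exists_equiv_of_ncard_fiber_eq (fun k => s' (Sum.inl k))
    (fun i : {i // s i < 1} => s i) fun r => ?_
  by_cases hr : r < 1
  · have e1 : {k | s' k = r} = Sum.inl '' {k | s' (Sum.inl k) = r} := by
      ext (k | k)
      · simp
      · simpa [hone] using hr.ne'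
    have e2 : {i | s i = r} = Subtype.val '' {i : {i // s i < 1} | s i = r} := by
      ext i
      simp only [Set.mem_ofPred_eq, Set.mem_image, Subtype.exists, exists_and_left,
        exists_prop, exists_eq_right_right]
      exact ⟨fun hi => ⟨hi, hi.trans_lt hr⟩, fun hi => hi.1⟩
    have := hfib r hr
    rw [e1, e2, Set.ncard_image_of_injective _ Sum.inl_injective,
      Set.ncard_image_of_injective _ Subtype.val_injective] at this
    exact this.symm
  · have e1 : {k | s' (Sum.inl k) = r} = ∅ :=
      Set.eq_empty_of_forall_notMem fun k hk => hr (Eq.trans_lt (Eq.symm hk) (hlt k))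
    have e2 : {i : {i // s i < 1} | s i = r} = ∅ :=
      Set.eq_empty_of_forall_notMem fun i hi => hr (Eq.trans_lt (Eq.symm hi) i.2)
    rw [e1, e2, Set.ncard_empty, Set.ncard_empty]

end SingularValueDecompositions

/-! ### Oblique projections and products of isometries -/

section ObliqueProjection

open ContinuousLinearMap

variable {K : Type*} [NormedAddCommGroup K] [InnerProductSpace ℂ K]

/-- With the next lemma: `T` is the graph of minus the corner over `Sᗮ`. -/
theorem sub_obliqueCorner_mem {S T : Submodule ℂ K} (h : IsCompl S T) (w : Sᗮ) :
    (w : K) - obliqueCorner S T h w ∈ T := by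
  rw [← Submodule.projectionOnto_apply_eq_zero_iff h, map_sub, Submodule.projectionOnto_apply_left]
  simp [obliqueCorner]

theorem exists_sub_obliqueCorner_eq {S T : Submodule ℂ K} [S.HasOrthogonalProjection]
    (h : IsCompl S T) {t : K} (ht : t ∈ T) : ∃ w : Sᗮ, (w : K) - obliqueCorner S T h w = t := by
  obtain ⟨y, hy, z, hz, rfl⟩ := S.exists_add_mem_mem_orthogonal t
  refine ⟨⟨z, hz⟩, ?_⟩
  have h1 : S.projectionOnto T h y + S.projectionOnto T h z = 0 := by
    rw [← map_add, Submodule.projectionOnto_apply_eq_zero_iff h]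
    exact ht
  rw [Submodule.projectionOnto_apply_of_mem_left h hy] at h1
  have h2 : (obliqueCorner S T h ⟨z, hz⟩ : K) = -y := by
    have := congrArg (Subtype.val) (eq_neg_of_add_eq_zero_right h1)
    simpa [obliqueCorner] using this
  rw [h2, sub_neg_eq_add, add_comm]

variable [FiniteDimensional ℂ K]

theorem exists_orthonormalBasis_obliqueCorner {S T : Submodule ℂ K} (h : IsCompl S T) {n : ℕ}
    (hn : Module.finrank ℂ Sᗮ = n) : ∃ v : OrthonormalBasis (Fin n) ℂ Sᗮ, ∀ k w,
      inner ℂ (obliqueCorner S T h w) (obliqueCorner S T h (v k)) =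
        (obliqueSingularValues S T h k : ℂ) ^ 2 * inner ℂ w (v k) := by
  have hsym := LinearMap.isSymmetric_adjoint_comp_self (𝕜 := ℂ) (obliqueCorner S T h)
  refine ⟨hsym.eigenvectorBasis hn, fun k w => ?_⟩
  rw [← LinearMap.adjoint_inner_right, ← LinearMap.comp_apply, hsym.apply_eigenvectorBasis hn,
    inner_smul_right, obliqueSingularValues, ← Complex.ofReal_pow,
    LinearMap.sq_singularValues_fin _ hn]
  rfl

variable {H : Type*} [NormedAddCommGroup H] [InnerProductSpace ℂ H] [CompleteSpace H]

/-- $AA^*$ is the projection onto $(\ker A^*)^\perp$: the difference $AA^*x-x$ lies in $\ker A^*$,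
so it is orthogonal to `x` and to the range of `A`, hence to itself. -/
theorem apply_adjoint_apply_of_mem_orthogonal_ker {A : H →L[ℂ] H} (hA : adjoint A ∘L A = 1) {x : H}
    (hx : ∀ y, adjoint A y = 0 → inner ℂ y x = 0) : A (adjoint A x) = x := by
  have hA' : ∀ y, adjoint A (A y) = y := fun y => congr($hA y)
  have h1 : adjoint A (A (adjoint A x) - x) = 0 := by rw [map_sub, hA', sub_self]
  rw [← sub_eq_zero, ← inner_self_eq_zero (𝕜 := ℂ), inner_sub_right, hx _ h1, sub_zero,
    ← adjoint_inner_left, h1, inner_zero_left]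

/-- The products `B* A` of isometries `A`, `B` with finite dimensional cokernels spanning a space
in which they are complementary: the singular values below `1` are `β / √(β² + 1)`, where `β` runs
through the singular values of the corner of the oblique projection. -/
theorem exists_isSVD_adjoint_comp {A B : H →L[ℂ] H} (hA : adjoint A ∘L A = 1)
    (hB : adjoint B ∘L B = 1) (hinj : Function.Injective (adjoint B ∘L A)) (j : K →ₗᵢ[ℂ] H)
    {S T : Submodule ℂ K} (h : IsCompl S T)
    (hS : ∀ y, adjoint A y = 0 ↔ ∃ x ∈ S, j x = y) (hT : ∀ y, adjoint B y = 0 ↔ ∃ x ∈ T, j x = y)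
    {n : ℕ} (hn : Module.finrank ℂ Sᗮ = n) :
    ∃ (κ : Set H) (s : Fin n ⊕ κ → ℝ) (f g : Fin n ⊕ κ → H),
      IsSVD (adjoint B ∘L A) s f g ∧
      (∀ k, s (Sum.inl k) = obliqueSingularValues S T h k /
        √(obliqueSingularValues S T h k ^ 2 + 1)) ∧ ∀ k, s (Sum.inr k) = 1 := by
  obtain ⟨v, hv⟩ := exists_orthonormalBasis_obliqueCorner h hn
  set β := obliqueSingularValues S T h with hβ
  have hβ0 : ∀ k, 0 ≤ β k := fun k => LinearMap.singularValues_nonneg _ k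
  have hA' : ∀ y, adjoint A (A y) = y := fun y => congr($hA y)
  have hAS : ∀ x ∈ S, adjoint A (j x) = 0 := fun x hx => (hS _).2 ⟨x, hx, rfl⟩
  have hBT : ∀ x ∈ T, adjoint B (j x) = 0 := fun x hx => (hT _).2 ⟨x, hx, rfl⟩
  have hAj : ∀ w : Sᗮ, A (adjoint A (j w)) = j w := fun w => by
    refine apply_adjoint_apply_of_mem_orthogonal_ker hA fun y hy => ?_
    obtain ⟨x, hx, rfl⟩ := (hS y).1 hy
    rw [j.inner_map_map]
    exact w.2 x hx
  -- the first right singular vectors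
  let g₀ : Fin n → H := fun k => adjoint A (j (v k))
  have hg₀ : Orthonormal ℂ g₀ := by
    rw [orthonormal_iff_ite]
    intro k l
    rw [adjoint_inner_left, hAj, j.inner_map_map, ← Submodule.coe_inner]
    exact orthonormal_iff_ite.1 v.orthonormal k l
  have hTg₀ : ∀ k x, inner ℂ ((adjoint B ∘L A) (g₀ k)) ((adjoint B ∘L A) x) =
      ((β k : ℂ) ^ 2 / ((β k : ℂ) ^ 2 + 1)) * inner ℂ (g₀ k) x := fun k x => by
    have hpos : ((β k : ℂ) ^ 2 + 1) ≠ 0 := by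
      rw [← Complex.ofReal_pow, ← Complex.ofReal_one, ← Complex.ofReal_add]
      exact Complex.ofReal_ne_zero.2 (by positivity)
    set c : ℂ := 1 / ((β k : ℂ) ^ 2 + 1) with hc
    set q := obliqueCorner S T h (v k) with hq
    have ht : ((v k : Sᗮ) : K) - q ∈ T := sub_obliqueCorner_mem h (v k)
    -- The vector `c • (v k - q)` is the projection of `v k` onto `T`. Against `w - qw` the vectors
    -- `v k` and `v k - q` give $\langle w,v_k\rangle$ and $(1+\beta_k^2)\langle w,v_k\rangle$,
    -- which dictates `c`.
    have hBB : B (adjoint B (j (v k))) = j (v k) - c • j (v k - q) := by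
      have h1 : B (adjoint B (j (v k) - c • j (v k - q))) = j (v k) - c • j (v k - q) := by
        refine apply_adjoint_apply_of_mem_orthogonal_ker hB fun y hy => ?_
        obtain ⟨t, ht, rfl⟩ := (hT y).1 hy
        obtain ⟨w, rfl⟩ := exists_sub_obliqueCorner_eq h ht
        have h2 : inner ℂ (obliqueCorner S T h w : K) (v k : K) = 0 :=
          (v k).2 _ (obliqueCorner S T h w).2
        have h3 : inner ℂ (w : K) (q : K) = 0 := inner_eq_zero_symm.1 (w.2 _ q.2)
        have h4 := hv k w
        rw [Submodule.coe_inner, Submodule.coe_inner, ← hq] at h4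
        rw [← map_smul, ← map_sub, j.inner_map_map]
        simp only [inner_sub_left, inner_sub_right, inner_smul_right, h2, h3, h4]
        rw [hc]
        field_simp
        ring
      rw [map_sub, map_smul, hBT _ ht, smul_zero, sub_zero] at h1
      exact h1
    have h5 : adjoint A (B (adjoint B (A (g₀ k)))) =
        ((β k : ℂ) ^ 2 / ((β k : ℂ) ^ 2 + 1)) • g₀ k := by
      rw [hAj, hBB, map_sub, map_smul, map_sub j, map_sub, hAS _ q.2, sub_zero, ← one_smul ℂ (g₀ k),
        smul_smul, show adjoint A (j (v k)) = g₀ k from rfl]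
      rw [show (β k : ℂ) ^ 2 / ((β k : ℂ) ^ 2 + 1) * 1 = 1 - c by rw [hc]; field_simp; ring,
        sub_smul, one_smul]
    rw [comp_apply, comp_apply, adjoint_inner_right, ← adjoint_inner_left, h5, inner_smul_left]
    simp
  -- the remaining ones
  let M : Submodule ℂ H := Submodule.span ℂ (Set.range g₀)
  have hTM : ∀ y ∈ Mᗮ, ∀ x, inner ℂ ((adjoint B ∘L A) y) ((adjoint B ∘L A) x) = inner ℂ y x :=
    fun y hy x => by
    have h1 : ∀ w : Sᗮ, inner ℂ (j w) (A y) = 0 := fun w => by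
      rw [← v.sum_repr w]
      simp only [Submodule.coe_sum, Submodule.coe_smul, map_sum, map_smul, sum_inner,
        inner_smul_left]
      refine Finset.sum_eq_zero fun k _ => ?_
      rw [← adjoint_inner_left, hy _ (Submodule.subset_span ⟨k, rfl⟩), mul_zero]
    -- `A y` is orthogonal to `Sᗮ` by `h1` and to `S = ker A*` as a value of `A`, hence to `T`.
    have h2 : B (adjoint B (A y)) = A y := by
      refine apply_adjoint_apply_of_mem_orthogonal_ker hB fun z hz => ?_
      obtain ⟨t, ht, rfl⟩ := (hT z).1 hz
      obtain ⟨w, rfl⟩ := exists_sub_obliqueCorner_eq h ht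
      rw [map_sub, inner_sub_left, h1, zero_sub, neg_eq_zero, ← adjoint_inner_left,
        hAS _ (obliqueCorner S T h w).2, inner_zero_left]
    rw [comp_apply, comp_apply, adjoint_inner_right, h2, ← adjoint_inner_left, hA']
  obtain ⟨κ₀, b, -⟩ := exists_hilbertBasis ℂ Mᗮ
  -- The index set is moved from `Mᗮ` into `H`, since the statement cannot mention `M`.
  let κ : Set H := Subtype.val '' κ₀
  let e : κ ≃ κ₀ := (Equiv.Set.image _ κ₀ Subtype.val_injective).symm
  let g : Fin n ⊕ κ → H := Sum.elim g₀ fun i => (b (e i) : H)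
  let s : Fin n ⊕ κ → ℝ := Sum.elim (fun k => β k / √(β k ^ 2 + 1)) fun _ => 1
  have horth : ∀ k i, inner ℂ (g₀ k) (b i : H) = 0 := fun k i =>
    (b i).2 _ (Submodule.subset_span ⟨k, rfl⟩)
  have hg : Orthonormal ℂ g := by
    refine ⟨?_, ?_⟩
    · rintro (k | i)
      exacts [hg₀.1 k, b.orthonormal.1 (e i)]
    · rintro (k | i) (l | i') hne
      · exact hg₀.2 fun hkl => hne (congrArg _ hkl)
      · exact horth k _
      · exact inner_eq_zero_symm.1 (horth l _)
      · exact b.orthonormal.2 fun hii => hne (congrArg _ (e.injective hii))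
  have htot : IsTotalFamily g := fun x hx => by
    have hxM : x ∈ Mᗮ := by
      rw [Submodule.mem_orthogonal]
      intro u hu
      refine Submodule.span_induction ?_ (by simp) (fun x y _ _ hx hy => ?_)
        (fun c x _ hx => ?_) hu
      · rintro _ ⟨k, rfl⟩
        exact hx (Sum.inl k)
      · rw [inner_add_left, hx, hy, add_zero]
      · rw [inner_smul_left, hx, mul_zero]
    have h0 : (⟨x, hxM⟩ : Mᗮ) = 0 := by
      refine b.repr.injective ?_
      rw [map_zero]
      ext i
      rw [b.repr_apply_apply]
      obtain ⟨i, rfl⟩ := e.surjective i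
      exact hx (Sum.inr i)
    exact congrArg Subtype.val h0
  have hsq : ∀ k, ((β k / √(β k ^ 2 + 1) : ℝ) : ℂ) ^ 2 = (β k : ℂ) ^ 2 / ((β k : ℂ) ^ 2 + 1) :=
    fun k => by
    have : 0 ≤ β k ^ 2 + 1 := by positivity
    rw [← Complex.ofReal_pow, div_pow, Real.sq_sqrt this]
    push_cast
    rfl
  have hT' : ∀ i x, inner ℂ ((adjoint B ∘L A) (g i)) ((adjoint B ∘L A) x) =
      (s i : ℂ) ^ 2 * inner ℂ (g i) x := by
    rintro (k | i) x
    · rw [show s (Sum.inl k) = β k / √(β k ^ 2 + 1) from rfl, hsq]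
      exact hTg₀ k x
    · rw [show s (Sum.inr i) = 1 from rfl, Complex.ofReal_one, one_pow, one_mul]
      exact hTM _ (b (e i)).2 x
  -- A vanishing singular value would put a unit vector into the kernel of `B* A`.
  have hs : ∀ i, 0 < s i := by
    rintro (k | i)
    · refine lt_of_le_of_ne (div_nonneg (hβ0 k) (Real.sqrt_nonneg _)) fun h0 => ?_
      have h1 := hT' (Sum.inl k) (g (Sum.inl k))
      rw [← h0, Complex.ofReal_zero, zero_pow two_ne_zero, zero_mul, inner_self_eq_zero] at h1
      exact hg.ne_zero (Sum.inl k) (hinj (h1.trans (map_zero _).symm))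
    · exact one_pos
  exact ⟨κ, s, _, g, IsSVD.of_orthonormal hg htot hs hT', fun _ => rfl, fun _ => rfl⟩

end ObliqueProjection

noncomputable section

/-! ### Multiplication operators and Fourier coefficients -/

section Multiplication

theorem mulOp_one : mulOp 1 = 1 := by
  ext1 f
  refine Lp.ext ?_
  filter_upwards [coeFn_mulOp 1 f] with x hx
  simp [hx]

theorem mulOp_mul (φ ψ : C(UnitAddCircle, ℂ)) : mulOp (φ * ψ) = mulOp φ ∘L mulOp ψ := by
  ext1 f
  refine Lp.ext ?_
  filter_upwards [coeFn_mulOp (φ * ψ) f, coeFn_mulOp φ (mulOp ψ f), coeFn_mulOp ψ f]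
    with x h1 h2 h3
  rw [h1, ContinuousLinearMap.comp_apply, h2, h3, ContinuousMap.mul_apply, mul_assoc]

theorem mulOp_mul_apply (φ ψ : C(UnitAddCircle, ℂ)) (f : L2T) :
    mulOp (φ * ψ) f = mulOp φ (mulOp ψ f) := by
  rw [mulOp_mul, ContinuousLinearMap.comp_apply]

/-- The multiplication operator as a function of its symbol. -/
def mulOpL : C(UnitAddCircle, ℂ) →L[ℂ] L2T →L[ℂ] L2T :=
  (ContinuousLinearMap.mul ℂ ℂ).holderL AddCircle.haarAddCircle ∞ 2 2 ∘L
    ContinuousMap.toLp ∞ AddCircle.haarAddCircle ℂ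

theorem mulOpL_apply (φ : C(UnitAddCircle, ℂ)) : mulOpL φ = mulOp φ := rfl

theorem mulOp_sub_apply (φ ψ : C(UnitAddCircle, ℂ)) (f : L2T) :
    mulOp (φ - ψ) f = mulOp φ f - mulOp ψ f := by
  simp only [← mulOpL_apply, map_sub, sub_apply]

theorem mulOp_smul_apply (c : ℂ) (φ : C(UnitAddCircle, ℂ)) (f : L2T) :
    mulOp (c • φ) f = c • mulOp φ f := by
  simp only [← mulOpL_apply, map_smul, smul_apply]

theorem mulOp_toLp (φ ψ : C(UnitAddCircle, ℂ)) :
    mulOp φ (ContinuousMap.toLp 2 AddCircle.haarAddCircle ℂ ψ) =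
      ContinuousMap.toLp 2 AddCircle.haarAddCircle ℂ (φ * ψ) := by
  refine Lp.ext ?_
  filter_upwards [coeFn_mulOp φ (ContinuousMap.toLp 2 AddCircle.haarAddCircle ℂ ψ),
    ContinuousMap.coeFn_toLp (p := 2) (𝕜 := ℂ) AddCircle.haarAddCircle ψ,
    ContinuousMap.coeFn_toLp (p := 2) (𝕜 := ℂ) AddCircle.haarAddCircle (φ * ψ)] with x h1 h2 h3
  rw [h1, h2, h3, ContinuousMap.mul_apply]

theorem inner_mulOp_left (φ : C(UnitAddCircle, ℂ)) (f g : L2T) :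
    inner ℂ (mulOp φ f) g = inner ℂ f (mulOp (star φ) g) := by
  rw [L2.inner_def, L2.inner_def]
  refine integral_congr_ae ?_
  filter_upwards [coeFn_mulOp φ f, coeFn_mulOp (star φ) g] with x h1 h2
  rw [h1, h2]
  simp only [RCLike.inner_apply, map_mul, ContinuousMap.star_apply]
  rw [← starRingEnd_apply]
  ring

theorem inner_mulOp_right (φ : C(UnitAddCircle, ℂ)) (f g : L2T) :
    inner ℂ f (mulOp φ g) = inner ℂ (mulOp (star φ) f) g := by
  rw [inner_mulOp_left, star_star]

theorem star_fourier (n : ℤ) : star (fourier n : C(UnitAddCircle, ℂ)) = fourier (-n) := by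
  ext x
  rw [ContinuousMap.star_apply, fourier_neg]
  rfl

theorem fourierBasis_eq (n : ℤ) : fourierBasis (T := 1) n =
    ContinuousMap.toLp 2 AddCircle.haarAddCircle ℂ (fourier n) := by
  rw [coe_fourierBasis]

theorem mulOp_fourier_fourierBasis (m n : ℤ) :
    mulOp (fourier m) (fourierBasis (T := 1) n) = fourierBasis (T := 1) (m + n) := by
  rw [fourierBasis_eq, fourierBasis_eq, mulOp_toLp]
  congr 1
  ext x
  rw [ContinuousMap.mul_apply, fourier_add]

theorem inner_fourierBasis_mulOp_fourier_one (n : ℤ) (f : L2T) :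
    inner ℂ (fourierBasis (T := 1) n) (mulOp (fourier 1) f) =
      inner ℂ (fourierBasis (T := 1) (n - 1)) f := by
  rw [inner_mulOp_right, star_fourier, mulOp_fourier_fourierBasis, neg_add_eq_sub]

theorem mem_hardySpace_iff {f : L2T} :
    f ∈ hardySpace ↔ ∀ n : ℤ, n < 0 → inner ℂ (fourierBasis (T := 1) n) f = 0 := by
  refine forall₂_congr fun n _ => ?_
  rw [← fourierBasis_repr, HilbertBasis.repr_apply_apply]

theorem eq_zero_of_inner_fourierBasis {f : L2T}
    (h : ∀ n : ℤ, inner ℂ (fourierBasis (T := 1) n) f = 0) : f = 0 := by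
  refine (fourierBasis (T := 1)).repr.injective ?_
  rw [map_zero]
  ext n
  rw [HilbertBasis.repr_apply_apply, h]
  rfl

theorem inner_fourierBasis_fourierBasis (m n : ℤ) :
    inner ℂ (fourierBasis (T := 1) m) (fourierBasis (T := 1) n) = if m = n then 1 else 0 :=
  orthonormal_iff_ite.1 fourierBasis.orthonormal m n

theorem fourierBasis_mem_hardySpace (n : ℕ) : fourierBasis (T := 1) n ∈ hardySpace := by
  rw [mem_hardySpace_iff]
  intro m hm
  rw [inner_fourierBasis_fourierBasis, if_neg (by lia)]

theorem exists_orthonormal_isTotalFamily_hardySpace :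
    ∃ u : ℕ → hardySpace, Orthonormal ℂ u ∧ IsTotalFamily u := by
  refine ⟨fun n => ⟨_, fourierBasis_mem_hardySpace n⟩, ?_, fun h hh => ?_⟩
  · rw [orthonormal_iff_ite]
    intro m n
    rw [Submodule.coe_inner, inner_fourierBasis_fourierBasis]
    simp
  · refine Subtype.ext (eq_zero_of_inner_fourierBasis fun n => ?_)
    obtain hn | hn := lt_or_ge n 0
    · exact mem_hardySpace_iff.1 h.2 n hn
    · lift n to ℕ using hn
      exact hh n

end Multiplication

/-! ### Analytic symbols and Szegő kernels -/

section AnalyticSymbols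

/-- Multiplication by `φ` preserves the Hardy space. -/
def IsAnalyticSymbol (φ : C(UnitAddCircle, ℂ)) : Prop :=
  ∀ f ∈ hardySpace, mulOp φ f ∈ hardySpace

theorem IsAnalyticSymbol.one : IsAnalyticSymbol 1 := fun f hf => by
  rwa [mulOp_one]

theorem IsAnalyticSymbol.mul {φ ψ : C(UnitAddCircle, ℂ)} (hφ : IsAnalyticSymbol φ)
    (hψ : IsAnalyticSymbol ψ) : IsAnalyticSymbol (φ * ψ) := fun f hf => by
  rw [mulOp_mul_apply]
  exact hφ _ (hψ _ hf)

theorem IsAnalyticSymbol.sub {φ ψ : C(UnitAddCircle, ℂ)} (hφ : IsAnalyticSymbol φ)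
    (hψ : IsAnalyticSymbol ψ) : IsAnalyticSymbol (φ - ψ) := fun f hf => by
  rw [mulOp_sub_apply]
  exact sub_mem (hφ _ hf) (hψ _ hf)

theorem IsAnalyticSymbol.smul {φ : C(UnitAddCircle, ℂ)} (hφ : IsAnalyticSymbol φ) (c : ℂ) :
    IsAnalyticSymbol (c • φ) := fun f hf => by
  rw [mulOp_smul_apply]
  exact Submodule.smul_mem _ _ (hφ _ hf)

theorem IsAnalyticSymbol.prod {ι : Type*} (s : Finset ι) {φ : ι → C(UnitAddCircle, ℂ)}
    (h : ∀ i ∈ s, IsAnalyticSymbol (φ i)) : IsAnalyticSymbol (∏ i ∈ s, φ i) := by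
  classical
  induction s using Finset.induction_on with
  | empty => simpa using IsAnalyticSymbol.one
  | insert i s hi ih =>
    rw [Finset.prod_insert hi]
    exact (h i (by simp)).mul (ih fun j hj => h j (by simp [hj]))

theorem IsAnalyticSymbol.pow {φ : C(UnitAddCircle, ℂ)} (h : IsAnalyticSymbol φ) (n : ℕ) :
    IsAnalyticSymbol (φ ^ n) := by
  simpa using IsAnalyticSymbol.prod (Finset.range n) (φ := fun _ => φ) fun _ _ => h

theorem isAnalyticSymbol_fourier_one : IsAnalyticSymbol (fourier 1) := fun f hf => by
  rw [mem_hardySpace_iff] at hf ⊢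
  intro n hn
  rw [inner_fourierBasis_mulOp_fourier_one, hf _ (by lia)]

theorem IsAnalyticSymbol.of_hasSum {φ : ℕ → C(UnitAddCircle, ℂ)} {ψ : C(UnitAddCircle, ℂ)}
    (h : ∀ i, IsAnalyticSymbol (φ i)) (hs : HasSum φ ψ) : IsAnalyticSymbol ψ := fun f hf => by
  have h1 := (hs.mapL mulOpL).mapL (ContinuousLinearMap.apply ℂ L2T f)
  exact isClosed_hardySpace.mem_of_tendsto h1.tendsto_sum_nat
    (Filter.Eventually.of_forall fun _ => Submodule.sum_mem _ fun i _ => h i f hf)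

/-- The Szegő kernel as a continuous function on the circle. -/
def szegoT (w : 𝔻) : C(UnitAddCircle, ℂ) :=
  ⟨fun x : UnitAddCircle => 1 / (1 - conj (w : ℂ) * (AddCircle.toCircle x : ℂ)),
    continuous_const.div (continuous_const.sub (continuous_const.mul
      (continuous_subtype_val.comp AddCircle.continuous_toCircle)))
      fun _ => one_sub_conj_mul_ne_zero w _⟩

theorem szego_eq_toLp (w : 𝔻) :
    szego w = ContinuousMap.toLp 2 AddCircle.haarAddCircle ℂ (szegoT w) := rfl

theorem szegoT_apply (w : 𝔻) (x : UnitAddCircle) :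
    szegoT w x = 1 / (1 - conj (w : ℂ) * (AddCircle.toCircle x : ℂ)) := rfl

theorem szegoT_mul (w : 𝔻) : szegoT w * (1 - conj (w : ℂ) • fourier 1) = 1 := by
  ext x
  simp only [ContinuousMap.mul_apply, ContinuousMap.sub_apply, ContinuousMap.smul_apply,
    ContinuousMap.one_apply, fourier_one, szegoT_apply, smul_eq_mul]
  exact one_div_mul_cancel (one_sub_conj_mul_ne_zero w _)

/-- The geometric series of $\bar wz$ converges uniformly, because $|w|<1$. -/
theorem isAnalyticSymbol_szegoT (w : 𝔻) : IsAnalyticSymbol (szegoT w) := by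
  set x : C(UnitAddCircle, ℂ) := conj (w : ℂ) • fourier 1 with hx
  have hlt : ‖x‖ < 1 := by
    rw [hx, norm_smul, fourier_norm, mul_one, Complex.norm_conj]
    exact w.norm_lt_one
  have hs := (summable_geometric_of_norm_lt_one hlt).hasSum
  have h1 : szegoT w = ∑' i : ℕ, x ^ i := by
    rw [← mul_one (szegoT w), ← mul_neg_geom_series x hlt, ← mul_assoc, szegoT_mul, one_mul]
  rw [← h1] at hs
  exact IsAnalyticSymbol.of_hasSum (fun i => (isAnalyticSymbol_fourier_one.smul _).pow i) hs

theorem szego_eq_mulOp (w : 𝔻) : szego w = mulOp (szegoT w) (fourierBasis (T := 1) 0) := by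
  rw [fourierBasis_eq, mulOp_toLp, szego_eq_toLp]
  congr 1
  ext x
  simp

theorem szego_mem_hardySpace (w : 𝔻) : szego w ∈ hardySpace := by
  rw [szego_eq_mulOp]
  exact isAnalyticSymbol_szegoT w _ (fourierBasis_mem_hardySpace 0)

theorem szego_sub_smul_mulOp (w : 𝔻) :
    szego w - conj (w : ℂ) • mulOp (fourier 1) (szego w) = fourierBasis (T := 1) 0 := by
  have h : mulOp (1 - conj (w : ℂ) • fourier 1) (szego w) = fourierBasis (T := 1) 0 := by
    rw [szego_eq_mulOp, ← mulOp_mul_apply, mul_comm, szegoT_mul, mulOp_one]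
    rfl
  rwa [mulOp_sub_apply, mulOp_smul_apply, mulOp_one] at h

theorem inner_fourierBasis_szego (w : 𝔻) (n : ℕ) :
    inner ℂ (fourierBasis (T := 1) n) (szego w) = conj (w : ℂ) ^ n := by
  have h : ∀ m : ℤ, inner ℂ (fourierBasis (T := 1) m) (szego w) - conj (w : ℂ) *
      inner ℂ (fourierBasis (T := 1) (m - 1)) (szego w) = if m = 0 then 1 else 0 := fun m => by
    rw [← inner_fourierBasis_fourierBasis, ← szego_sub_smul_mulOp w, inner_sub_right,
      inner_smul_right, inner_fourierBasis_mulOp_fourier_one]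
  induction n with
  | zero =>
    have := h 0
    rw [mem_hardySpace_iff.1 (szego_mem_hardySpace w) (0 - 1) (by lia)] at this
    simpa using this
  | succ n ih =>
    have := h (n + 1)
    rw [if_neg (by lia), sub_eq_zero, add_sub_cancel_right, ih] at this
    rw [pow_succ', Nat.cast_succ]
    exact this

/-- Pairing with $c_w$ is evaluation at $w$, so the shift becomes multiplication by $w$. The reason
is $\bar zc_w-\bar wc_w=\bar z\perp H^2$. -/
theorem inner_szego_mulOp_fourier_one (w : 𝔻) {f : L2T} (hf : f ∈ hardySpace) :
    inner ℂ (szego w) (mulOp (fourier 1) f) = w * inner ℂ (szego w) f := by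
  have h : mulOp (star (fourier 1)) (szego w) - conj (w : ℂ) • szego w =
      fourierBasis (T := 1) (-1) := by
    have h1 := congrArg (mulOp (fourier (-1))) (szego_sub_smul_mulOp w)
    rw [map_sub, map_smul, ← mulOp_mul_apply, mulOp_fourier_fourierBasis] at h1
    rw [star_fourier]
    have h2 : (fourier (-1) * fourier 1 : C(UnitAddCircle, ℂ)) = 1 := by
      ext x
      rw [ContinuousMap.mul_apply, ← fourier_add]
      simp
    rwa [h2, mulOp_one] at h1
  have h3 := mem_hardySpace_iff.1 hf (-1) (by lia)
  rw [← h, inner_sub_left, inner_smul_left, ← inner_mulOp_right, Complex.conj_conj] at h3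
  exact sub_eq_zero.1 h3

theorem inner_szego_szego (v w : 𝔻) :
    inner ℂ (szego v) (szego w) = 1 / (1 - conj (w : ℂ) * v) := by
  have h1 : inner ℂ (szego v) (fourierBasis (T := 1) 0) = 1 := by
    have := inner_fourierBasis_szego v 0
    rw [← inner_conj_symm, Nat.cast_zero] at this
    simpa using congrArg conj this
  rw [← szego_sub_smul_mulOp w, inner_sub_right, inner_smul_right,
    inner_szego_mulOp_fourier_one v (szego_mem_hardySpace w)] at h1
  refine eq_one_div_of_mul_eq_one_left ?_
  linear_combination h1

/-- The coefficient sequences $(\bar w^n)_n$ are eigenvectors of the backward shift with distinct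
eigenvalues $\bar w$. -/
theorem linearIndependent_szego {ι : Type*} {c : ι → 𝔻} (hc : Function.Injective c) :
    LinearIndependent ℂ fun i => szego (c i) := by
  let coeff : L2T →ₗ[ℂ] (ℕ → ℂ) :=
    LinearMap.pi fun n : ℕ => (innerSL ℂ (fourierBasis (T := 1) n)).toLinearMap
  have hcoeff : ∀ i n, coeff (szego (c i)) n = conj (c i : ℂ) ^ n := fun i n =>
    inner_fourierBasis_szego (c i) n
  refine LinearIndependent.of_comp coeff ?_
  refine Module.End.eigenvectors_linearIndependent' (LinearMap.funLeft ℂ ℂ Nat.succ)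
    (fun i => conj (c i : ℂ)) (fun i j hij => hc ?_) _ fun i => ⟨?_, fun h0 => ?_⟩
  · exact Complex.UnitDisc.coe_injective ((starRingEnd ℂ).injective hij)
  · rw [Module.End.mem_eigenspace_iff]
    ext n
    rw [LinearMap.funLeft_apply, Pi.smul_apply, Function.comp_apply, hcoeff, hcoeff, smul_eq_mul,
      pow_succ']
  · have := hcoeff i 0
    rw [show coeff (szego (c i)) = 0 from h0] at this
    simp at this

end AnalyticSymbols
end

noncomputable section

/-! ### Toeplitz operators -/

section ToeplitzOperators

open ContinuousLinearMap

theorem inner_toeplitz (φ : C(UnitAddCircle, ℂ)) (f g : hardySpace) :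
    inner ℂ (toeplitz φ f) g = inner ℂ (mulOp φ f) (g : L2T) :=
  Submodule.inner_orthogonalProjectionOnto_eq_of_mem_right g _

theorem coe_toeplitz {φ : C(UnitAddCircle, ℂ)} (hφ : IsAnalyticSymbol φ) (f : hardySpace) :
    (toeplitz φ f : L2T) = mulOp φ f :=
  congrArg Subtype.val (hardySpace.orthogonalProjectionOnto_mem_subspace_eq_self
    ⟨mulOp φ f, hφ _ f.2⟩)

theorem toeplitz_one : toeplitz 1 = 1 := by
  ext1 f
  refine Subtype.ext ?_
  rw [coe_toeplitz IsAnalyticSymbol.one, mulOp_one]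
  rfl

theorem adjoint_toeplitz (φ : C(UnitAddCircle, ℂ)) : adjoint (toeplitz φ) = toeplitz (star φ) := by
  symm
  rw [eq_adjoint_iff]
  intro f g
  rw [inner_toeplitz, inner_mulOp_left, star_star, ← inner_conj_symm, ← inner_toeplitz]
  exact inner_conj_symm (𝕜 := ℂ) f (toeplitz φ g)

theorem toeplitz_mul {φ ψ : C(UnitAddCircle, ℂ)} (hψ : IsAnalyticSymbol ψ) :
    toeplitz (φ * ψ) = toeplitz φ ∘L toeplitz ψ := by
  ext1 f
  refine ext_inner_right ℂ fun g => ?_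
  rw [inner_toeplitz, comp_apply, inner_toeplitz, coe_toeplitz hψ, mulOp_mul_apply]

theorem adjoint_toeplitz_eq_zero_iff (φ : C(UnitAddCircle, ℂ)) (f : hardySpace) :
    adjoint (toeplitz φ) f = 0 ↔ ∀ h ∈ hardySpace, inner ℂ (mulOp φ h) (f : L2T) = 0 := by
  refine ⟨fun hf h hh => ?_, fun hf => ext_inner_left ℂ fun h => ?_⟩
  · rw [← inner_toeplitz φ ⟨h, hh⟩, ← adjoint_inner_right, hf, inner_zero_right]
  · rw [adjoint_inner_right, inner_toeplitz, hf _ h.2, inner_zero_right]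

end ToeplitzOperators

/-! ### Blaschke products, model spaces and injectivity -/

section BlaschkeProducts

open ContinuousLinearMap

/-- The Blaschke factor `(z - w) / (1 - w̄ z)` on the circle. -/
def blaschkeFactor (w : 𝔻) : C(UnitAddCircle, ℂ) := (fourier 1 - (w : ℂ) • 1) * szegoT w

theorem isAnalyticSymbol_blaschkeFactor (w : 𝔻) : IsAnalyticSymbol (blaschkeFactor w) :=
  (isAnalyticSymbol_fourier_one.sub (IsAnalyticSymbol.one.smul _)).mul (isAnalyticSymbol_szegoT w)

theorem blaschkeT_eq_prod {n : ℕ} (a : Fin n → 𝔻) :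
    blaschkeT a = ∏ j, blaschkeFactor (a j) := by
  ext x
  rw [ContinuousMap.prod_apply]
  refine Eq.trans (b := ∏ j, ((AddCircle.toCircle x : ℂ) - a j) /
    (1 - conj (a j : ℂ) * (AddCircle.toCircle x : ℂ))) rfl (Finset.prod_congr rfl fun j _ => ?_)
  simp only [blaschkeFactor, ContinuousMap.mul_apply, ContinuousMap.sub_apply,
    ContinuousMap.smul_apply, ContinuousMap.one_apply, fourier_one, szegoT_apply, smul_eq_mul,
    mul_one, div_eq_mul_inv, one_mul]

theorem isAnalyticSymbol_blaschkeT {n : ℕ} (a : Fin n → 𝔻) : IsAnalyticSymbol (blaschkeT a) := by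
  rw [blaschkeT_eq_prod]
  exact IsAnalyticSymbol.prod _ fun _ _ => isAnalyticSymbol_blaschkeFactor _

theorem star_blaschkeFactor_mul_self (w : 𝔻) : star (blaschkeFactor w) * blaschkeFactor w = 1 := by
  ext x
  set z : ℂ := (AddCircle.toCircle x : ℂ) with hz
  have hz1 : conj z * z = 1 := by
    rw [← Complex.normSq_eq_conj_mul_self, Complex.normSq_eq_norm_sq, Circle.norm_coe]
    simp
  have h1 : 1 - conj (w : ℂ) * z ≠ 0 := one_sub_conj_mul_ne_zero w _
  have h2 : 1 - w * conj z ≠ 0 := by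
    have := (map_ne_zero (starRingEnd ℂ)).2 h1
    simpa using this
  have h3 : 1 - conj z * w ≠ 0 := by rwa [mul_comm]
  simp only [blaschkeFactor, ContinuousMap.mul_apply, ContinuousMap.sub_apply,
    ContinuousMap.smul_apply, ContinuousMap.one_apply, fourier_one, szegoT_apply, smul_eq_mul,
    mul_one, ContinuousMap.star_apply, ← starRingEnd_apply, map_mul, map_sub, map_div₀, map_one,
    Complex.conj_conj, ← hz]
  field_simp
  -- $|z-w|^2-|1-\bar wz|^2=(1-|w|^2)(|z|^2-1)$.
  linear_combination (1 - w * conj (w : ℂ)) * hz1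

theorem star_blaschkeT_mul_self {n : ℕ} (a : Fin n → 𝔻) : star (blaschkeT a) * blaschkeT a = 1 := by
  rw [blaschkeT_eq_prod, star_prod, ← Finset.prod_mul_distrib]
  exact Finset.prod_eq_one fun j _ => star_blaschkeFactor_mul_self _

theorem adjoint_toeplitz_blaschkeT_comp {n : ℕ} (a : Fin n → 𝔻) :
    adjoint (toeplitz (blaschkeT a)) ∘L toeplitz (blaschkeT a) = 1 := by
  rw [adjoint_toeplitz, ← toeplitz_mul (isAnalyticSymbol_blaschkeT a), star_blaschkeT_mul_self,
    toeplitz_one]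

theorem toeplitz_blaschkeQuotient {n m : ℕ} (a : Fin n → 𝔻) (b : Fin m → 𝔻) :
    toeplitz (blaschkeQuotient a b) =
      adjoint (toeplitz (blaschkeT b)) ∘L toeplitz (blaschkeT a) := by
  rw [adjoint_toeplitz, ← toeplitz_mul (isAnalyticSymbol_blaschkeT a)]
  congr 1
  ext x
  have h1 : star (blaschkeT b) x * blaschkeT b x = 1 :=
    congr($(star_blaschkeT_mul_self b) x)
  have h2 : blaschkeT b x ≠ 0 := blaschke_ne_zero b _
  rw [ContinuousMap.mul_apply, eq_inv_of_mul_eq_one_left h1, mul_comm, ← div_eq_mul_inv]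
  rfl

/-- Functions in the Hardy space orthogonal to `(z - w) / (1 - w̄ z) H²` are multiples of the Szegő
kernel. -/
theorem adjoint_toeplitz_blaschkeFactor_eq_zero_iff (w : 𝔻) (f : hardySpace) :
    adjoint (toeplitz (blaschkeFactor w)) f = 0 ↔ ∃ c : ℂ, (f : L2T) = c • szego w := by
  have hev : ∀ h ∈ hardySpace, inner ℂ (szego w) (mulOp (fourier 1 - (w : ℂ) • 1) h) = 0 :=
    fun h hh => by
      rw [mulOp_sub_apply, mulOp_smul_apply, mulOp_one, inner_sub_right, inner_smul_right,
        inner_szego_mulOp_fourier_one w hh]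
      exact sub_self _
  rw [adjoint_toeplitz_eq_zero_iff]
  refine ⟨fun hf => ⟨inner ℂ (fourierBasis (T := 1) 0) (f : L2T), ?_⟩, ?_⟩
  · have hrec : ∀ n : ℕ, inner ℂ (fourierBasis (T := 1) ((n + 1 : ℕ) : ℤ)) (f : L2T) =
        conj (w : ℂ) * inner ℂ (fourierBasis (T := 1) n) (f : L2T) := fun n => by
      -- Testing against $(1-\bar wz)z^n$ cancels the denominator of the Blaschke factor and leaves
      -- $(z-w)z^n$.
      have h1 := hf (mulOp (1 - conj (w : ℂ) • fourier 1) (fourierBasis (T := 1) n))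
        ((IsAnalyticSymbol.one.sub (isAnalyticSymbol_fourier_one.smul _)) _
          (fourierBasis_mem_hardySpace n))
      rw [← mulOp_mul_apply, blaschkeFactor, mul_assoc, szegoT_mul, mul_one, mulOp_sub_apply,
        mulOp_smul_apply, mulOp_one, mulOp_fourier_fourierBasis, inner_sub_left,
        one_apply_eq_self, inner_smul_left] at h1
      rw [Nat.cast_succ, add_comm]
      exact sub_eq_zero.1 h1
    have hcoeff : ∀ n : ℕ, inner ℂ (fourierBasis (T := 1) n) (f : L2T) =
        conj (w : ℂ) ^ n * inner ℂ (fourierBasis (T := 1) 0) (f : L2T) := fun n => by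
      induction n with
      | zero => simp
      | succ n ih => rw [hrec, ih, pow_succ', mul_assoc]
    rw [← sub_eq_zero]
    refine eq_zero_of_inner_fourierBasis fun n => ?_
    rw [inner_sub_right, inner_smul_right]
    obtain hn | hn := lt_or_ge n 0
    · rw [mem_hardySpace_iff.1 f.2 n hn, mem_hardySpace_iff.1 (szego_mem_hardySpace w) n hn,
        mul_zero, sub_zero]
    · lift n to ℕ using hn
      rw [hcoeff, inner_fourierBasis_szego, mul_comm, sub_self]
  · rintro ⟨c, hc⟩ h hh
    rw [hc, inner_smul_right, blaschkeFactor, mulOp_mul_apply, inner_eq_zero_symm.1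
      (hev _ (isAnalyticSymbol_szegoT w h hh)), mul_zero]

/-- `f` maps $\ker(g\circ f)$ into $\ker g$, with kernel inside $\ker f$. Cardinal ranks are used
because finite dimensionality is only deduced from this bound. -/
theorem rank_ker_comp_le {R : Type*} [Field R] {V : Type*} [AddCommGroup V] [Module R V]
    (g f : V →ₗ[R] V) : Module.rank R (LinearMap.ker (g ∘ₗ f)) ≤
      Module.rank R (LinearMap.ker g) + Module.rank R (LinearMap.ker f) := by
  let F : LinearMap.ker (g ∘ₗ f) →ₗ[R] LinearMap.ker g :=
    f.restrict (p := LinearMap.ker (g ∘ₗ f)) fun x hx => hx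
  rw [← F.rank_range_add_rank_ker]
  refine add_le_add (Submodule.rank_le _) (LinearMap.rank_le_of_injective
    (((LinearMap.ker (g ∘ₗ f)).subtype ∘ₗ (LinearMap.ker F).subtype).codRestrict
      (LinearMap.ker f) fun x => congrArg Subtype.val x.2) fun x y hxy => ?_)
  have h := congrArg Subtype.val hxy
  exact Subtype.ext (Subtype.ext h)

theorem rank_ker_adjoint_toeplitz_prod_le {ι : Type*} (s : Finset ι) (c : ι → 𝔻) :
    Module.rank ℂ (LinearMap.ker
      (adjoint (toeplitz (∏ i ∈ s, blaschkeFactor (c i)))).toLinearMap) ≤ s.card := by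
  classical
  induction s using Finset.induction_on with
  | empty =>
    have : LinearMap.ker (adjoint (toeplitz 1)).toLinearMap = ⊥ := by
      rw [adjoint_toeplitz, star_one, toeplitz_one]
      exact LinearMap.ker_id
    rw [Finset.prod_empty, this]
    simp
  | insert i s hi ih =>
    have hle : LinearMap.ker (adjoint (toeplitz (blaschkeFactor (c i)))).toLinearMap ≤
        Submodule.span ℂ {⟨szego (c i), szego_mem_hardySpace (c i)⟩} := fun f hf => by
      obtain ⟨r, hr⟩ := (adjoint_toeplitz_blaschkeFactor_eq_zero_iff _ f).1 hf
      exact Submodule.mem_span_singleton.2 ⟨r, Subtype.ext hr.symm⟩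
    rw [Finset.prod_insert hi, mul_comm, toeplitz_mul (isAnalyticSymbol_blaschkeFactor _),
      adjoint_comp, Finset.card_insert_of_notMem hi, add_comm, Nat.cast_add, Nat.cast_one]
    refine (rank_ker_comp_le _ _).trans (add_le_add ?_ ih)
    exact (Submodule.rank_mono hle).trans ((rank_span_le _).trans (Cardinal.mk_singleton _).le)

theorem modelSpace_eq_map {n : ℕ} (c : Fin n → 𝔻) : modelSpace c =
    (LinearMap.ker (adjoint (toeplitz (blaschkeT c))).toLinearMap).map hardySpace.subtype := by
  ext f
  simp only [modelSpace, Submodule.mem_inf, Submodule.mem_orthogonal, Submodule.mem_map,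
    forall_exists_index, and_imp, forall_apply_eq_imp_iff₂]
  constructor
  · rintro ⟨hf, h⟩
    exact ⟨⟨f, hf⟩, (adjoint_toeplitz_eq_zero_iff _ _).2 h, rfl⟩
  · rintro ⟨f, hf, rfl⟩
    exact ⟨f.2, (adjoint_toeplitz_eq_zero_iff _ _).1 hf⟩

theorem adjoint_toeplitz_blaschkeT_eq_zero_iff {n : ℕ} (c : Fin n → 𝔻) (f : hardySpace) :
    adjoint (toeplitz (blaschkeT c)) f = 0 ↔ (f : L2T) ∈ modelSpace c := by
  rw [modelSpace_eq_map]
  refine ⟨fun hf => ⟨f, hf, rfl⟩, ?_⟩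
  rintro ⟨g, hg, hgf⟩
  rw [← Subtype.ext hgf]
  exact hg

theorem szegoSpan_le_modelSpace {n : ℕ} (c : Fin n → 𝔻) : szegoSpan c ≤ modelSpace c := by
  refine Submodule.span_le.2 ?_
  rintro _ ⟨j, rfl⟩
  refine (adjoint_toeplitz_blaschkeT_eq_zero_iff c ⟨_, szego_mem_hardySpace (c j)⟩).1
    ((adjoint_toeplitz_eq_zero_iff _ _).2 fun h hh => ?_)
  rw [blaschkeT_eq_prod, ← Finset.mul_prod_erase _ _ (Finset.mem_univ j), mulOp_mul_apply]
  exact (adjoint_toeplitz_eq_zero_iff _ _).1 ((adjoint_toeplitz_blaschkeFactor_eq_zero_iff (c j)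
    ⟨_, szego_mem_hardySpace (c j)⟩).2 ⟨1, (one_smul _ _).symm⟩) _
    (IsAnalyticSymbol.prod _ (fun _ _ => isAnalyticSymbol_blaschkeFactor _) _ hh)

theorem finrank_szegoSpan {n : ℕ} {c : Fin n → 𝔻} (hc : Function.Injective c) :
    Module.finrank ℂ (szegoSpan c) = n :=
  (finrank_span_eq_card (linearIndependent_szego hc)).trans (Fintype.card_fin n)

/-- Each Blaschke factor adds at most one dimension to the kernel, so the $n$ independent kernels
already fill the model space. -/
theorem modelSpace_eq_szegoSpan {n : ℕ} {c : Fin n → 𝔻} (hc : Function.Injective c) :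
    modelSpace c = szegoSpan c := by
  have h : Module.rank ℂ (modelSpace c) ≤ n := by
    rw [modelSpace_eq_map]
    refine (rank_map_le _ _).trans ?_
    have := rank_ker_adjoint_toeplitz_prod_le Finset.univ c
    rwa [← blaschkeT_eq_prod, Finset.card_univ, Fintype.card_fin] at this
  have : FiniteDimensional ℂ (modelSpace c) :=
    Module.rank_lt_aleph0_iff.1 (h.trans_lt Cardinal.natCast_lt_aleph0)
  refine (Submodule.eq_of_le_of_finrank_le (szegoSpan_le_modelSpace c) ?_).symm
  rw [finrank_szegoSpan hc]
  exact Module.finrank_le_of_rank_le h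

theorem szegoSpan_append {n m : ℕ} (a : Fin n → 𝔻) (b : Fin m → 𝔻) :
    szegoSpan (Fin.append a b) = szegoSpan a ⊔ szegoSpan b := by
  rw [szegoSpan, szegoSpan, szegoSpan, ← Submodule.span_union]
  congr 1
  ext f
  rw [Set.mem_union, Set.mem_range, Set.mem_range, Set.mem_range]
  constructor
  · rintro ⟨i, rfl⟩
    induction i using Fin.addCases with
    | left i => exact Or.inl ⟨i, by rw [Fin.append_left]⟩
    | right i => exact Or.inr ⟨i, by rw [Fin.append_right]⟩
  · rintro (⟨i, rfl⟩ | ⟨i, rfl⟩)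
    exacts [⟨Fin.castAdd m i, by rw [Fin.append_left]⟩, ⟨Fin.natAdd n i, by rw [Fin.append_right]⟩]

theorem disjoint_szegoSpan {n m : ℕ} {a : Fin n → 𝔻} {b : Fin m → 𝔻}
    (hab : Function.Injective (Fin.append a b)) : Disjoint (szegoSpan a) (szegoSpan b) := by
  have h := (linearIndependent_szego hab).disjoint_span_image
    (s := Set.range (Fin.castAdd m)) (t := Set.range (Fin.natAdd n)) (by
      rw [Set.disjoint_left]
      rintro _ ⟨i, rfl⟩ ⟨j, hj⟩
      have := congrArg Fin.val hj
      simp at this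
      lia)
  rw [← Set.range_comp, ← Set.range_comp] at h
  simpa [szegoSpan, Function.comp_def] using h

/-- A combination of the kernels `c_{b_k}` that vanishes at `n` further points is zero: the operator
`T_φ` has trivial kernel. -/
theorem eq_zero_of_mem_szegoSpan {n : ℕ} {a b : Fin n → 𝔻} (ha : Function.Injective a) {f : L2T}
    (hf : f ∈ szegoSpan b) (h : ∀ j, inner ℂ (szego (a j)) f = 0) : f = 0 := by
  classical
  obtain ⟨r, rfl⟩ := (Submodule.mem_span_range_iff_exists_fun ℂ).1 hf
  have hne : ∀ (w : 𝔻) (z : ℂ), ‖z‖ ≤ 1 → 1 - conj (w : ℂ) * z ≠ 0 := fun w z hz h0 => by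
    have h1 : ‖conj (w : ℂ) * z‖ = 1 := by rw [← sub_eq_zero.1 h0, norm_one]
    rw [norm_mul, Complex.norm_conj] at h1
    nlinarith [w.norm_lt_one, norm_nonneg z, norm_nonneg (w : ℂ)]
  -- The numerator of $\sum_k r_kc_{b_k}$ over the common denominator; each summand has $n-1$ linear
  -- factors.
  let P : Polynomial ℂ := ∑ k, Polynomial.C (r k) *
    ∏ l ∈ Finset.univ.erase k, (1 - Polynomial.C (conj (b l : ℂ)) * Polynomial.X)
  have heval : ∀ z : ℂ, ‖z‖ ≤ 1 → P.eval z = (∏ l, (1 - conj (b l : ℂ) * z)) *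
      ∑ k, r k * (1 / (1 - conj (b k : ℂ) * z)) := fun z hz => by
    simp only [P, Polynomial.eval_finsetSum, Polynomial.eval_mul, Polynomial.eval_C,
      Polynomial.eval_prod, Polynomial.eval_sub, Polynomial.eval_one, Polynomial.eval_X,
      Finset.mul_sum]
    refine Finset.sum_congr rfl fun k _ => ?_
    rw [← Finset.mul_prod_erase _ _ (Finset.mem_univ k)]
    have h1 := mul_one_div_cancel (hne (b k) z hz)
    linear_combination
      (-r k * ∏ l ∈ Finset.univ.erase k, (1 - conj (b l : ℂ) * z)) * h1
  have hroot : ∀ j, P.eval (a j : ℂ) = 0 := fun j => by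
    have h1 := h j
    simp only [inner_sum, inner_smul_right, inner_szego_szego] at h1
    rw [heval _ (a j).norm_lt_one.le, h1, mul_zero]
  have hP : P = 0 := by
    -- For `n = 0` the degree cannot be below `n`, but then `P` is an empty sum.
    rcases Nat.eq_zero_or_pos n with rfl | hn
    · simp [P]
    refine Polynomial.eq_zero_of_natDegree_lt_card_of_eval_eq_zero P
      (Complex.UnitDisc.coe_injective.comp ha) hroot ?_
    rw [Fintype.card_fin]
    refine lt_of_le_of_lt (Polynomial.natDegree_sum_le_of_forall_le _ _ (n := n - 1) fun k _ => ?_)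
      (Nat.sub_lt hn one_pos)
    refine (Polynomial.natDegree_C_mul_le _ _).trans ((Polynomial.natDegree_prod_le _ _).trans ?_)
    refine (Finset.sum_le_card_nsmul _ _ 1 fun l _ => ?_).trans (by simp)
    compute_degree
  have hT : ∑ k, r k • szegoT (b k) = 0 := by
    ext x
    have h1 := heval (AddCircle.toCircle x : ℂ) (Circle.norm_coe _).le
    rw [hP, Polynomial.eval_zero, eq_comm, mul_eq_zero, Finset.prod_eq_zero_iff] at h1
    have h2 := h1.resolve_left fun ⟨l, _, hl⟩ => hne _ _ (Circle.norm_coe _).le hl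
    simpa [ContinuousMap.sum_apply, szegoT_apply] using h2
  simp only [szego_eq_toLp, ← map_smul, ← map_sum]
  rw [hT, map_zero]

/-- If $T_\varphi f=0$, then $B_af$ lies in the span of the $c_{b_k}$ and is orthogonal to every
$c_{a_j}\in\ker T_{B_a}^*$, so it is zero. -/
theorem injective_toeplitz_blaschkeQuotient {n : ℕ} {a b : Fin n → 𝔻} (ha : Function.Injective a)
    (hb : Function.Injective b) : Function.Injective (toeplitz (blaschkeQuotient a b)) := by
  rw [injective_iff_map_eq_zero]
  intro f hf
  rw [toeplitz_blaschkeQuotient, comp_apply, adjoint_toeplitz_blaschkeT_eq_zero_iff,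
    modelSpace_eq_szegoSpan hb] at hf
  have h0 : toeplitz (blaschkeT a) f = 0 := by
    refine Subtype.ext (eq_zero_of_mem_szegoSpan ha hf fun j => ?_)
    have h1 := (adjoint_toeplitz_blaschkeT_eq_zero_iff a ⟨_, szego_mem_hardySpace (a j)⟩).2
      (szegoSpan_le_modelSpace a (Submodule.subset_span ⟨j, rfl⟩))
    have h2 := adjoint_inner_left (toeplitz (blaschkeT a)) f ⟨_, szego_mem_hardySpace (a j)⟩
    rw [h1, inner_zero_left] at h2
    exact h2.symm
  have h3 := congr($(adjoint_toeplitz_blaschkeT_comp a) f)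
  rw [comp_apply, h0, map_zero] at h3
  exact h3.symm

end BlaschkeProducts

end

/-! ### The main theorem -/

theorem mainTheorem8 {n : ℕ} (a b : Fin n → Complex.UnitDisc)
    (ha : Function.Injective a) (hb : Function.Injective b) (hab : ∀ j k, a j ≠ b k) :
    szegoSpan a ≤ modelSpace (Fin.append a b) ∧
    szegoSpan b ≤ modelSpace (Fin.append a b) ∧
    ∃ (_ : FiniteDimensional ℂ (modelSpace (Fin.append a b)))
      (hcompl : IsCompl ((szegoSpan a).submoduleOf (modelSpace (Fin.append a b)))
        ((szegoSpan b).submoduleOf (modelSpace (Fin.append a b)))),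
      (∃ (s : ℕ → ℝ) (f g : ℕ → hardySpace), IsSVD (toeplitz (blaschkeQuotient a b)) s f g) ∧
      ∀ (ι : Type*) (s : ι → ℝ) (f g : ι → hardySpace),
        IsSVD (toeplitz (blaschkeQuotient a b)) s f g →
          (∀ i, s i ≤ 1) ∧ {i | s i < 1}.Finite ∧
          ∃ e : Fin n ≃ {i // s i < 1}, ∀ k : Fin n,
            s (e k) = obliqueSingularValues _ _ hcompl k /
              √(obliqueSingularValues _ _ hcompl k ^ 2 + 1) := by
  have hinj : Function.Injective (Fin.append a b) := Fin.append_injective_iff.2 ⟨ha, hb, hab⟩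
  have hK : modelSpace (Fin.append a b) = szegoSpan a ⊔ szegoSpan b := by
    rw [modelSpace_eq_szegoSpan hinj, szegoSpan_append]
  have hSK : szegoSpan a ≤ modelSpace (Fin.append a b) := hK ▸ le_sup_left
  have hTK : szegoSpan b ≤ modelSpace (Fin.append a b) := hK ▸ le_sup_right
  have hfin : FiniteDimensional ℂ (modelSpace (Fin.append a b)) := by
    rw [modelSpace_eq_szegoSpan hinj]
    exact FiniteDimensional.span_of_finite ℂ (Set.finite_range _)
  have hcompl : IsCompl ((szegoSpan a).submoduleOf (modelSpace (Fin.append a b)))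
      ((szegoSpan b).submoduleOf (modelSpace (Fin.append a b))) := by
    constructor
    · rw [Submodule.disjoint_def]
      intro x hx hy
      exact Subtype.ext (Submodule.disjoint_def.1 (disjoint_szegoSpan hinj) x hx hy)
    · rw [codisjoint_iff, eq_top_iff]
      rintro ⟨x, hx⟩ -
      have hx' := hx
      rw [hK] at hx'
      obtain ⟨y, hy, z, hz, rfl⟩ := Submodule.mem_sup.1 hx'
      exact Submodule.mem_sup.2 ⟨⟨y, hSK hy⟩, hy, ⟨z, hTK hz⟩, hz, rfl⟩
  refine ⟨hSK, hTK, hfin, hcompl, ?_⟩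
  have hrank : Module.finrank ℂ ((szegoSpan a).submoduleOf (modelSpace (Fin.append a b)))ᗮ = n := by
    have h1 := Submodule.finrank_add_finrank_orthogonal
      ((szegoSpan a).submoduleOf (modelSpace (Fin.append a b)))
    have h2 : Module.finrank ℂ ((szegoSpan a).submoduleOf (modelSpace (Fin.append a b))) = n :=
      (Submodule.submoduleOfEquivOfLe hSK).finrank_eq.trans (finrank_szegoSpan ha)
    have h3 : Module.finrank ℂ (modelSpace (Fin.append a b)) = n + n := by
      rw [modelSpace_eq_szegoSpan hinj, finrank_szegoSpan hinj]
    rw [h2, h3] at h1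
    exact Nat.add_left_cancel h1
  let j : modelSpace (Fin.append a b) →ₗᵢ[ℂ] hardySpace :=
    ⟨Submodule.inclusion inf_le_left, fun _ => rfl⟩
  have hker : ∀ {c : Fin n → Complex.UnitDisc}, Function.Injective c →
      szegoSpan c ≤ modelSpace (Fin.append a b) → ∀ y : hardySpace,
      ContinuousLinearMap.adjoint (toeplitz (blaschkeT c)) y = 0 ↔
        ∃ x ∈ (szegoSpan c).submoduleOf (modelSpace (Fin.append a b)), j x = y :=
    fun hc hle y => by
    rw [adjoint_toeplitz_blaschkeT_eq_zero_iff, modelSpace_eq_szegoSpan hc]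
    refine ⟨fun hy => ⟨⟨y, hle hy⟩, hy, rfl⟩, ?_⟩
    rintro ⟨x, hx, rfl⟩
    exact hx
  have hT := injective_toeplitz_blaschkeQuotient ha hb
  obtain ⟨κ, s', f', g', h', hs, hone⟩ := exists_isSVD_adjoint_comp
    (adjoint_toeplitz_blaschkeT_comp a) (adjoint_toeplitz_blaschkeT_comp b)
    (toeplitz_blaschkeQuotient a b ▸ hT) j hcompl (hker ha hSK) (hker hb hTK) hrank
  rw [← toeplitz_blaschkeQuotient] at h'
  constructor
  -- Comparison with the basis $(z^n)$ of $H^2$ shows that `Fin n ⊕ κ` is countably infinite, so it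
  -- can be replaced by `ℕ`.
  · obtain ⟨u, hu, hutot⟩ := exists_orthonormal_isTotalFamily_hardySpace
    have := h'.right_orthonormal.countable_of_isTotalFamily hutot
    have := hu.infinite_of_isTotalFamily h'.right_orthonormal (h'.isTotalFamily hT)
    obtain ⟨e⟩ := nonempty_equiv_of_countable (α := ℕ) (β := Fin n ⊕ κ)
    exact ⟨_, _, _, h'.reindex e⟩
  · intro ι s f g h
    have hlt : ∀ k, s' (Sum.inl k) < 1 := fun k => by
      rw [hs, div_lt_one (Real.sqrt_pos.2 (by positivity))]
      exact Real.lt_sqrt_of_sq_lt (lt_add_one _)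
    obtain ⟨h1, h2, e, he⟩ := h'.exists_equiv hT hlt hone h
    exact ⟨h1, h2, e, fun k => (he k).trans (hs k)⟩
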